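/- Let $K>0$ (capacity of a finite energy buffer) and $M>0$ (desired transmit power). Let $(X(i))_{i\ge 0}$ be an i.i.d. sequence of nonnegative random variables (harvested energy) whose common law $\nu$ has a probability density function and an infinite positive tail, i.e. $\mathbb{P}(X(i)>x)>0$ for every $x\in\mathbb{R}$. Let $B(0)$ be a random variable with values in $[0,K]$, independent of $(X(i))_{i\ge0}$, and let the storage process $(B(i))_{i\ge 0}$ be given either by the best-effort policy, $$B(i+1)=\min\big([B(i)-M]^+ + X(i),\,K\big),$$ or by the on-off policy, $$B(i+1)=\min\big(B(i)-M\,\mathbf{1}_{\{B(i)>M\}}+X(i),\,K\big).$$ Then, for each of the two policies, the Markov chain $(B(i))$ on $[0,K]$ possesses a unique stationary distribution $\pi$. It has a density on $(0,K)$ and an atom at $K$: there is a measurable $g\ge 0$ on $(0,K)$ with $$\pi(A)=\int_{A\cap(0,K)}g(x)\,dx+\pi(\{K\})\,\mathbf{1}_{K\in A}\quad\text{for all Borel sets } A,\qquad \pi(\{K\})>0.$$ If $B(0)$ has law $\pi$, then $(B(i))_{i\ge 0}$ is a stationary and ergodic process (its law on the space of sequences is invariant and ergodic under the shift). Furthermore,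 for every initial distribution on $[0,K]$, i.e. for every law of $B(0)$, the process converges to $\pi$ in total variation: $$\lim_{n\to\infty}\ \sup_{A}\big|\mathbb{P}(B(n)\in A)-\pi(A)\big|=0,$$ where the supremum is over all Borel sets $A$. -/

import Mathlib

open MeasureTheory ProbabilityTheory Filter Topology Set
open scoped ENNReal

noncomputable section

namespace EnergyStorage

/-- The two transmission policies. -/
inductive Policy where
  | bestEffort
  | onOff

/-- The energy drawn from the buffer in one slot, when the desired transmit power is `M` and the
stored energy is `b`: `min (b, M)` for best effort and `M · 1_{b > M}` for on-off. -/
def Policy.power (M : ℝ) : Policy → ℝ → ℝ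
  | .bestEffort, b => min b M
  | .onOff, b => if M < b then M else 0

/-- The storage equation with buffer capacity `K`: from the stored energy `b` and the harvested
energy `x` of a slot to the stored energy at the beginning of the next slot. -/
def step (pol : Policy) (K M b x : ℝ) : ℝ := min (b - pol.power M b + x) K

/-- Best effort: `B(i+1) = min ([B(i) - M]⁺ + X(i), K)`. -/
theorem step_bestEffort (K M b x : ℝ) :
    step .bestEffort K M b x = min (max (b - M) 0 + x) K := by
  have h : b - min b M = max (b - M) 0 := by
    rcases le_total b M with hb | hb
    · rw [min_eq_left hb, max_eq_right (by linarith)]; ring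
    · rw [min_eq_right hb, max_eq_left (by linarith)]
  simp only [step, Policy.power, h]

theorem measurable_power (pol : Policy) (M : ℝ) : Measurable (pol.power M) := by
  cases pol with
  | bestEffort => exact measurable_id.min measurable_const
  | onOff => exact Measurable.ite measurableSet_Ioi measurable_const measurable_const

theorem measurable_step (pol : Policy) (K M : ℝ) :
    Measurable (fun p : ℝ × ℝ => step pol K M p.1 p.2) :=
  ((measurable_fst.sub ((measurable_power pol M).comp measurable_fst)).add
    measurable_snd).min measurable_const

/-- The probability law `ν` of the harvested energy `X(i)` of one slot: it lives on `[0, ∞)` and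
has a probability density function and an infinite positive tail. -/
structure IsHarvestLaw (ν : Measure ℝ) : Prop where
  nonneg : ν (Iio 0) = 0
  exists_pdf : ∃ f : ℝ → ℝ≥0∞, Measurable f ∧ ν = volume.withDensity f
  tail : ∀ x : ℝ, 0 < ν (Ioi x)

/-- The transition kernel of the storage chain: from the state `b`, the next state is
`step pol K M b X` with `X` distributed according to `ν`. -/
def kernel (pol : Policy) (K M : ℝ) (ν : Measure ℝ) [IsProbabilityMeasure ν] : Kernel ℝ ℝ where
  toFun b := ν.map (step pol K M b)
  measurable' := by
    refine Measure.measurable_of_measurable_coe _ fun s hs => ?_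
    have h : ∀ b, ν.map (step pol K M b) s =
        ν (Prod.mk b ⁻¹' ((fun p : ℝ × ℝ => step pol K M p.1 p.2) ⁻¹' s)) := fun b =>
      Measure.map_apply ((measurable_step pol K M).comp measurable_prodMk_left) hs
    simp only [h]
    exact measurable_measure_prodMk_left (measurable_step pol K M hs)

/-- The probability measure `π` is a stationary distribution of the storage chain on the state space `[0, K]`. -/
structure IsStationaryDistribution (pol : Policy) (K M : ℝ) (ν : Measure ℝ)
    [IsProbabilityMeasure ν] (π : Measure ℝ) : Prop where
  isProbabilityMeasure : IsProbabilityMeasure π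
  supported : π (Icc 0 K)ᶜ = 0
  invariant : (kernel pol K M ν).Invariant π

/-- `B` is a storage process on the probability space `(Ω, P)`: it solves the storage equation for
an i.i.d. harvesting process `X` with one-slot law `ν`, and its initial value lies in `[0, K]` and
is independent of the whole process `X`. -/
structure IsStorageProcess (pol : Policy) (K M : ℝ) (ν : Measure ℝ) {Ω : Type*}
    [MeasurableSpace Ω] (P : Measure Ω) (X B : ℕ → Ω → ℝ) : Prop where
  measurable_harvest : ∀ i, Measurable (X i)
  law_harvest : ∀ i, P.map (X i) = ν
  iIndep_harvest : iIndepFun X P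
  measurable_init : Measurable (B 0)
  init_mem : ∀ᵐ ω ∂P, B 0 ω ∈ Icc 0 K
  indep_init : IndepFun (B 0) (fun ω i => X i ω) P
  storage_eq : ∀ i ω, B (i + 1) ω = step pol K M (B i ω) (X i ω)

/-- Total variation distance of two probability measures, `sup_A |μ(A) - μ'(A)|`. -/
def tvDist (μ μ' : Measure ℝ) : ℝ :=
  ⨆ A : {A : Set ℝ // MeasurableSet A}, |μ.real A - μ'.real A|

/-- The process `B` is stationary and ergodic: its law on the sequence space is invariant under the
shift (this is part of Mathlib's `Ergodic`), and shift-invariant events have probability 0 or 1. -/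
def IsStationaryErgodic {Ω : Type*} [MeasurableSpace Ω] (P : Measure Ω) (B : ℕ → Ω → ℝ) : Prop :=
  Ergodic (fun (b : ℕ → ℝ) i => b (i + 1)) (P.map (fun ω i => B i ω))

end EnergyStorage

end

namespace EnergyStorage

noncomputable section

/-! ### The storage equation -/

section Step

variable {pol : Policy} {K M b x : ℝ}

/-! A slot's draw never exceeds the stored energy, so a harvest of at least `K` fills the buffer
from any state (`step_eq_capacity`). This has probability `p = ν [K, ∞) > 0` because the tail is
infinite, so full buffers are regeneration times and Doeblin's method applies to both policies
alike.

The occupation measure of a cycle between fillings, normalised by `p`, is stationary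
(`push_stationary`). After `n` slots two laws agree up to mass `(1 - p) ^ n` (`exists_common_part`),
giving uniqueness and convergence in total variation. Absolute continuity of `ν` excludes null sets
that miss `K` (`push_apply_eq_zero`).

Ergodicity is a coupling argument. Paths with the same harvests merge at the first filling
(`exists_merge`), so a shift-invariant event is almost surely a tail event of the harvests, and
Kolmogorov's zero-one law applies. -/

theorem power_le (hb : 0 ≤ b) : pol.power M b ≤ b := by
  cases pol with
  | bestEffort => exact min_le_left _ _
  | onOff =>
    simp only [Policy.power]
    split_ifs with h
    · exact h.le
    · exact hb

theorem step_le : step pol K M b x ≤ K := min_le_right _ _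

theorem step_nonneg (hK : 0 < K) (hb : 0 ≤ b) (hx : 0 ≤ x) :
    0 ≤ step pol K M b x :=
  le_min (by linarith [power_le (pol := pol) (M := M) hb]) hK.le

theorem step_eq_capacity (hb : 0 ≤ b) (hx : K ≤ x) : step pol K M b x = K :=
  min_eq_right (by linarith [power_le (pol := pol) (M := M) hb])

end Step

/-! ### One step of the chain acting on measures -/

/-- The law of the next state when the state has law `μ` and the independent harvest has
law `ρ`; the measures need not be normalised. -/
def push (pol : Policy) (K M : ℝ) (ρ μ : Measure ℝ) : Measure ℝ :=
  (μ.prod ρ).map (fun p : ℝ × ℝ => step pol K M p.1 p.2)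

section Push

variable (pol : Policy) (K M : ℝ) (ρ ρ' μ μ' : Measure ℝ)

/-- Allows working with `push`, which accepts unnormalised harvest laws such as `ν` restricted to
`Iio K`. -/
theorem bind_kernel [IsProbabilityMeasure ρ] [SFinite μ] :
    μ.bind (kernel pol K M ρ) = push pol K M ρ μ := by
  ext s hs
  have hm := measurable_step pol K M
  rw [Measure.bind_apply hs (kernel pol K M ρ).aemeasurable, push, Measure.map_apply hm hs,
    Measure.prod_apply (hm hs)]
  refine lintegral_congr fun b => ?_
  exact Measure.map_apply (hm.comp measurable_prodMk_left) hs

instance [IsFiniteMeasure ρ] [IsFiniteMeasure μ] : IsFiniteMeasure (push pol K M ρ μ) := by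
  unfold push; infer_instance

instance [IsProbabilityMeasure ρ] [IsProbabilityMeasure μ] :
    IsProbabilityMeasure (push pol K M ρ μ) :=
  Measure.isProbabilityMeasure_map (measurable_step pol K M).aemeasurable

theorem push_univ [SFinite ρ] : push pol K M ρ μ univ = μ univ * ρ univ := by
  rw [push, Measure.map_apply (measurable_step pol K M) MeasurableSet.univ, preimage_univ,
    ← univ_prod_univ, Measure.prod_prod]

theorem push_add_left [SFinite ρ] [SFinite ρ'] [SFinite μ] :
    push pol K M (ρ + ρ') μ = push pol K M ρ μ + push pol K M ρ' μ := by
  rw [push, Measure.prod_add, Measure.map_add _ _ (measurable_step pol K M)]; rfl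

theorem push_add_right [SFinite ρ] [SFinite μ] [SFinite μ'] :
    push pol K M ρ (μ + μ') = push pol K M ρ μ + push pol K M ρ μ' := by
  rw [push, Measure.add_prod, Measure.map_add _ _ (measurable_step pol K M)]; rfl

theorem push_smul [SFinite ρ] (c : ℝ≥0∞) : push pol K M ρ (c • μ) = c • push pol K M ρ μ := by
  rw [push, Measure.prod_smul_left, Measure.map_smul]; rfl

theorem push_sum {ι : Type*} [SFinite ρ] (m : ι → Measure ℝ) :
    push pol K M ρ (Measure.sum m) = Measure.sum fun i => push pol K M ρ (m i) := by
  rw [push, Measure.prod_sum_left, Measure.map_sum (measurable_step pol K M).aemeasurable]; rfl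

variable {pol K M ρ μ}

theorem ae_push_mem [SFinite ρ] (hK : 0 < K) (hρ : ∀ᵐ x ∂ρ, 0 ≤ x)
    (hμ : ∀ᵐ b ∂μ, 0 ≤ b) : ∀ᵐ b ∂push pol K M ρ μ, b ∈ Icc 0 K := by
  refine (ae_map_iff (measurable_step pol K M).aemeasurable measurableSet_Icc).2 ?_
  have h1 : ∀ᵐ p ∂μ.prod ρ, 0 ≤ p.1 := Measure.quasiMeasurePreserving_fst.ae hμ
  have h2 : ∀ᵐ p ∂μ.prod ρ, 0 ≤ p.2 := Measure.quasiMeasurePreserving_snd.ae hρ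
  filter_upwards [h1, h2] with p hp1 hp2 using ⟨step_nonneg hK hp1 hp2, step_le⟩

/-- The part of the harvest law that fills the buffer in one slot. -/
theorem push_restrict_Ici [SFinite ρ] (hμ : ∀ᵐ b ∂μ, 0 ≤ b) :
    push pol K M (ρ.restrict (Ici K)) μ = (μ univ * ρ (Ici K)) • Measure.dirac K := by
  have h1 : ∀ᵐ p ∂μ.prod (ρ.restrict (Ici K)), 0 ≤ p.1 :=
    Measure.quasiMeasurePreserving_fst.ae hμ
  have h2 : ∀ᵐ p ∂μ.prod (ρ.restrict (Ici K)), K ≤ p.2 :=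
    Measure.quasiMeasurePreserving_snd.ae (ae_restrict_mem measurableSet_Ici)
  have h : (fun p : ℝ × ℝ => step pol K M p.1 p.2) =ᵐ[μ.prod (ρ.restrict (Ici K))]
      fun _ => K := by
    filter_upwards [h1, h2] with p hp1 hp2 using step_eq_capacity hp1 hp2
  rw [push, Measure.map_congr h, Measure.map_const, ← univ_prod_univ, Measure.prod_prod,
    Measure.restrict_apply_univ]

/-- Minorisation: whatever the state, the buffer is filled with probability `ν [K, ∞)`. -/
theorem push_eq_add_dirac [SFinite ρ] [SFinite μ] (hμ : ∀ᵐ b ∂μ, 0 ≤ b) :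
    push pol K M ρ μ =
      push pol K M (ρ.restrict (Iio K)) μ + (μ univ * ρ (Ici K)) • Measure.dirac K := by
  have h : ρ.restrict (Iio K) + ρ.restrict (Ici K) = ρ := by
    rw [← compl_Iio]; exact Measure.restrict_add_restrict_compl measurableSet_Iio
  rw [← push_restrict_Ici hμ, ← push_add_left, h]

end Push

section HarvestLaw

variable {pol : Policy} {K M : ℝ} {ν : Measure ℝ}

theorem IsHarvestLaw.ae_nonneg (hν : IsHarvestLaw ν) : ∀ᵐ x ∂ν, 0 ≤ x := by
  rw [ae_iff]; simpa [← Iio_def] using hν.nonneg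

theorem IsHarvestLaw.absolutelyContinuous (hν : IsHarvestLaw ν) : ν ≪ volume := by
  obtain ⟨f, -, rfl⟩ := hν.exists_pdf
  exact withDensity_absolutelyContinuous _ _

theorem IsHarvestLaw.Ici_pos (hν : IsHarvestLaw ν) (K : ℝ) : 0 < ν (Ici K) :=
  (hν.tail K).trans_le (measure_mono Ioi_subset_Ici_self)

theorem Iio_add_Ici [IsProbabilityMeasure ν] (K : ℝ) : ν (Iio K) + ν (Ici K) = 1 := by
  rw [← compl_Iio, prob_add_prob_compl measurableSet_Iio]

theorem IsHarvestLaw.Iio_lt_one [IsProbabilityMeasure ν] (hν : IsHarvestLaw ν) (K : ℝ) :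
    ν (Iio K) < 1 := by
  rw [← Iio_add_Ici (ν := ν) K]
  exact ENNReal.lt_add_right (measure_ne_top _ _) (hν.Ici_pos K).ne'

/-! ### Existence of a stationary distribution -/

/-- The law of the state, on the event that no harvest has filled the buffer for `n` slots,
started from a full buffer. -/
def unfilled (pol : Policy) (K M : ℝ) (ν : Measure ℝ) (n : ℕ) : Measure ℝ :=
  (push pol K M (ν.restrict (Iio K)))^[n] (Measure.dirac K)

/-- The stationary distribution, as the occupation measure of a cycle between two fillings. -/
def stationary (pol : Policy) (K M : ℝ) (ν : Measure ℝ) : Measure ℝ :=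
  ν (Ici K) • Measure.sum (unfilled pol K M ν)

theorem unfilled_succ (n : ℕ) : unfilled pol K M ν (n + 1) =
    push pol K M (ν.restrict (Iio K)) (unfilled pol K M ν n) :=
  Function.iterate_succ_apply' _ _ _

theorem unfilled_univ [SFinite ν] (n : ℕ) : unfilled pol K M ν n univ = ν (Iio K) ^ n := by
  induction n with
  | zero => simp [unfilled]
  | succ n ih => rw [unfilled_succ, push_univ, ih, Measure.restrict_apply_univ, pow_succ]

theorem ae_unfilled_mem [SFinite ν] (hK : 0 < K) (hν : IsHarvestLaw ν) (n : ℕ) :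
    ∀ᵐ b ∂unfilled pol K M ν n, b ∈ Icc 0 K := by
  induction n with
  | zero => simp [unfilled, hK.le]
  | succ n ih =>
    rw [unfilled_succ]
    exact ae_push_mem hK (ae_restrict_of_ae hν.ae_nonneg) (ih.mono fun _ h => h.1)

theorem isProbabilityMeasure_stationary [IsProbabilityMeasure ν] (hν : IsHarvestLaw ν) :
    IsProbabilityMeasure (stationary pol K M ν) := by
  constructor
  have hp : ν (Ici K) = 1 - ν (Iio K) :=
    ENNReal.eq_sub_of_add_eq' ENNReal.one_ne_top (by rw [add_comm, Iio_add_Ici])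
  simp only [stationary, Measure.smul_apply, Measure.sum_apply _ MeasurableSet.univ,
    unfilled_univ, ENNReal.tsum_geometric, smul_eq_mul]
  rw [← hp]
  exact ENNReal.mul_inv_cancel (hν.Ici_pos K).ne' (measure_ne_top _ _)

theorem ae_stationary_mem [SFinite ν] (hK : 0 < K) (hν : IsHarvestLaw ν) :
    ∀ᵐ b ∂stationary pol K M ν, b ∈ Icc 0 K :=
  Measure.ae_smul_measure (Measure.ae_sum_iff.2 fun n => ae_unfilled_mem hK hν n) _

/-- A slot without filling shifts the series of `unfilled` laws by one index; the filling mass `ν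
(Ici K)` at `K` restores the missing zeroth term. -/
theorem push_stationary [IsProbabilityMeasure ν] (hK : 0 < K)
    (hν : IsHarvestLaw ν) : push pol K M ν (stationary pol K M ν) = stationary pol K M ν := by
  have := isProbabilityMeasure_stationary (pol := pol) (K := K) (M := M) hν
  rw [push_eq_add_dirac ((ae_stationary_mem hK hν).mono fun _ h => h.1), measure_univ,
    one_mul]
  nth_rw 1 [stationary]
  rw [push_smul, push_sum, ← smul_add, stationary]
  congr 1
  ext s hs
  rw [Measure.add_apply, Measure.sum_apply _ hs, Measure.sum_apply _ hs,
    tsum_eq_zero_add' (f := fun n => unfilled pol K M ν n s) ENNReal.summable, add_comm]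
  simp only [unfilled_succ]
  rfl

theorem isStationaryDistribution_stationary [IsProbabilityMeasure ν] (hK : 0 < K)
    (hν : IsHarvestLaw ν) : IsStationaryDistribution pol K M ν (stationary pol K M ν) where
  isProbabilityMeasure := isProbabilityMeasure_stationary hν
  supported := ae_iff.1 (ae_stationary_mem hK hν)
  invariant := by
    have := isProbabilityMeasure_stationary (pol := pol) (K := K) (M := M) hν
    rw [Kernel.Invariant, bind_kernel, push_stationary hK hν]

theorem IsStationaryDistribution.push_eq [IsProbabilityMeasure ν] {π : Measure ℝ}
    (hπ : IsStationaryDistribution pol K M ν π) : push pol K M ν π = π := by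
  have := hπ.isProbabilityMeasure
  rw [← bind_kernel]; exact hπ.invariant

theorem IsStationaryDistribution.ae_mem [IsProbabilityMeasure ν] {π : Measure ℝ}
    (hπ : IsStationaryDistribution pol K M ν π) : ∀ᵐ b ∂π, b ∈ Icc 0 K :=
  ae_iff.2 hπ.supported

/-! ### Geometric convergence -/

/-- Up to a part of mass `ν (-∞, K) ^ n`, the law after `n` slots does not depend on the
initial law. -/
theorem exists_common_part [IsProbabilityMeasure ν] (hK : 0 < K)
    (hν : IsHarvestLaw ν) (n : ℕ) :
    ∃ σ : Measure ℝ, IsFiniteMeasure σ ∧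
      ∀ μ : Measure ℝ, IsProbabilityMeasure μ → (∀ᵐ b ∂μ, b ∈ Icc 0 K) →
      IsProbabilityMeasure ((push pol K M ν)^[n] μ) ∧
      (∀ᵐ b ∂(push pol K M ν)^[n] μ, b ∈ Icc 0 K) ∧
      ∃ τ : Measure ℝ, (push pol K M ν)^[n] μ = σ + τ ∧ τ univ = ν (Iio K) ^ n := by
  induction n with
  | zero => exact ⟨0, inferInstance, fun μ h h' => ⟨h, h', μ, by simp, by simp⟩⟩
  | succ n ih =>
    obtain ⟨σ, hσ, h⟩ := ih
    -- The new Dirac mass is the same for every `μ`, since all laws at time `n` have total mass 1.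
    -- Only `τ` still remembers `μ`.
    refine ⟨push pol K M (ν.restrict (Iio K)) σ + ν (Ici K) • Measure.dirac K,
      ⟨by simp [push_univ, ENNReal.mul_lt_top]⟩, fun μ hμ hμ' => ?_⟩
    obtain ⟨h1, h2, τ, h3, h4⟩ := h μ hμ hμ'
    have hτ : IsFiniteMeasure τ :=
      ⟨by rw [h4]; exact ENNReal.pow_lt_top (measure_lt_top _ _)⟩
    simp only [Function.iterate_succ_apply']
    refine ⟨inferInstance, ae_push_mem hK hν.ae_nonneg (h2.mono fun _ h => h.1),
      push pol K M (ν.restrict (Iio K)) τ, ?_, ?_⟩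
    · rw [push_eq_add_dirac (h2.mono fun _ h => h.1), measure_univ, one_mul]
      nth_rw 1 [h3]
      rw [push_add_right]
      abel
    · rw [push_univ, h4, Measure.restrict_apply_univ, pow_succ]

/-- The common part cancels, and each remainder gives `A` a mass between 0 and `ν (Iio K) ^ n`. -/
theorem abs_sub_le [IsProbabilityMeasure ν] (hK : 0 < K)
    (hν : IsHarvestLaw ν) (n : ℕ) {μ μ' : Measure ℝ} [IsProbabilityMeasure μ]
    [IsProbabilityMeasure μ'] (hμ : ∀ᵐ b ∂μ, b ∈ Icc 0 K) (hμ' : ∀ᵐ b ∂μ', b ∈ Icc 0 K)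
    (A : Set ℝ) :
    |((push pol K M ν)^[n] μ).real A - ((push pol K M ν)^[n] μ').real A| ≤
      ν.real (Iio K) ^ n := by
  obtain ⟨σ, hσ, h⟩ := exists_common_part (pol := pol) (M := M) hK hν n
  obtain ⟨-, -, τ, h1, h2⟩ := h μ inferInstance hμ
  obtain ⟨-, -, τ', h1', h2'⟩ := h μ' inferInstance hμ'
  have hτ : IsFiniteMeasure τ := ⟨by rw [h2]; exact ENNReal.pow_lt_top (measure_lt_top _ _)⟩
  have hτ' : IsFiniteMeasure τ' := ⟨by rw [h2']; exact ENNReal.pow_lt_top (measure_lt_top _ _)⟩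
  have e : τ.real univ = ν.real (Iio K) ^ n := by simp [Measure.real, h2]
  have e' : τ'.real univ = ν.real (Iio K) ^ n := by simp [Measure.real, h2']
  have l : τ.real A ≤ τ.real univ := measureReal_mono (subset_univ A)
  have l' : τ'.real A ≤ τ'.real univ := measureReal_mono (subset_univ A)
  rw [h1, h1', measureReal_add_apply, measureReal_add_apply, abs_le]
  constructor <;> linarith [measureReal_nonneg (μ := τ) (s := A),
    measureReal_nonneg (μ := τ') (s := A)]

theorem tendsto_Iio_pow [IsProbabilityMeasure ν] (hν : IsHarvestLaw ν) :
    Tendsto (fun n : ℕ => ν.real (Iio K) ^ n) atTop (𝓝 0) :=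
  tendsto_pow_atTop_nhds_zero_of_lt_one measureReal_nonneg <| by
    simpa [Measure.real] using
      (ENNReal.toReal_lt_toReal (measure_ne_top _ _) ENNReal.one_ne_top).2 (hν.Iio_lt_one K)

theorem IsStationaryDistribution.unique [IsProbabilityMeasure ν] (hK : 0 < K)
    (hν : IsHarvestLaw ν) {π π' : Measure ℝ} (hπ : IsStationaryDistribution pol K M ν π)
    (hπ' : IsStationaryDistribution pol K M ν π') : π = π' := by
  have := hπ.isProbabilityMeasure
  have := hπ'.isProbabilityMeasure
  refine Measure.ext fun A _ => (measureReal_eq_measureReal_iff).1 ?_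
  refine sub_eq_zero.1 (abs_eq_zero.1 (le_antisymm ?_ (abs_nonneg _)))
  refine ge_of_tendsto' (tendsto_Iio_pow (K := K) hν) fun n => ?_
  have h := abs_sub_le (pol := pol) (M := M) hK hν n hπ.ae_mem hπ'.ae_mem A
  rwa [Function.iterate_fixed hπ.push_eq, Function.iterate_fixed hπ'.push_eq] at h

theorem IsStationaryDistribution.tendsto_tvDist [IsProbabilityMeasure ν] (hK : 0 < K)
    (hν : IsHarvestLaw ν) {π μ : Measure ℝ} [IsProbabilityMeasure μ]
    (hπ : IsStationaryDistribution pol K M ν π) (hμ : ∀ᵐ b ∂μ, b ∈ Icc 0 K) :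
    Tendsto (fun n => tvDist ((push pol K M ν)^[n] μ) π) atTop (𝓝 0) := by
  have := hπ.isProbabilityMeasure
  refine squeeze_zero (fun n => Real.iSup_nonneg fun A => abs_nonneg _) (fun n => ?_)
    (tendsto_Iio_pow (K := K) hν)
  refine Real.iSup_le (fun A => ?_) (pow_nonneg measureReal_nonneg _)
  have h := abs_sub_le (pol := pol) (M := M) hK hν n hμ hπ.ae_mem A
  rwa [Function.iterate_fixed hπ.push_eq] at h

/-! ### Density and atom -/

/-- From a fixed state, entering `A` without being capped at `K` forces the harvest into a translate
of `A`, which is null. -/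
theorem push_apply_eq_zero {μ : Measure ℝ} [SFinite ν] (hν : ν ≪ volume) {A : Set ℝ}
    (hA : MeasurableSet A) (h0 : volume A = 0) (hKA : K ∉ A) : push pol K M ν μ A = 0 := by
  have hm := measurable_step pol K M
  rw [push, Measure.map_apply hm hA, Measure.measure_prod_null (hm hA)]
  refine Eventually.of_forall fun b => ?_
  have hs : Prod.mk b ⁻¹' ((fun p : ℝ × ℝ => step pol K M p.1 p.2) ⁻¹' A) ⊆
      (fun x => (b - pol.power M b) + x) ⁻¹' A := by
    intro x hx
    rcases min_choice (b - pol.power M b + x) K with h | h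
    · simpa [step, h] using hx
    · exact absurd (by simpa [step, h] using hx) hKA
  refine hν (measure_mono_null hs ?_)
  rw [measure_preimage_add, h0]

theorem IsStationaryDistribution.exists_density [IsProbabilityMeasure ν]
    (hν : IsHarvestLaw ν) {π : Measure ℝ} (hπ : IsStationaryDistribution pol K M ν π) :
    ∃ g : ℝ → ℝ≥0∞, Measurable g ∧
      π = (volume.restrict (Ioo 0 K)).withDensity g + π {K} • Measure.dirac K := by
  have := hπ.isProbabilityMeasure
  have hnull : ∀ A : Set ℝ, MeasurableSet A → volume A = 0 → K ∉ A → π A = 0 := by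
    intro A hA h0 hKA
    rw [← hπ.push_eq]
    exact push_apply_eq_zero hν.absolutelyContinuous hA h0 hKA
  have hac : π.restrict (Ioo 0 K) ≪ volume.restrict (Ioo 0 K) := by
    refine Measure.AbsolutelyContinuous.mk fun A hA h0 => ?_
    rw [Measure.restrict_apply hA] at h0 ⊢
    exact hnull _ (hA.inter measurableSet_Ioo) h0 fun h => lt_irrefl K h.2.2
  refine ⟨(π.restrict (Ioo 0 K)).rnDeriv (volume.restrict (Ioo 0 K)),
    Measure.measurable_rnDeriv _ _, ?_⟩
  rw [Measure.withDensity_rnDeriv_eq _ _ hac, ← Measure.restrict_singleton,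
    ← Measure.restrict_union (by simp) (measurableSet_singleton K)]
  refine (Measure.restrict_eq_self_of_ae_mem ?_).symm
  -- The endpoint `0` carries no mass, being a null singleton, unless it coincides with `K`.
  have hpos : ∀ᵐ b ∂π, 0 < b ∨ b = K := by
    rcases eq_or_ne K 0 with rfl | hK0
    · filter_upwards [hπ.ae_mem] with b hb using Or.inr (le_antisymm hb.2 hb.1)
    · have h0 : π {0} = 0 := hnull _ (measurableSet_singleton 0) (by simp) (by simpa using hK0)
      filter_upwards [hπ.ae_mem, (measure_eq_zero_iff_ae_notMem.1 h0)] with b hb hb0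
      exact Or.inl (lt_of_le_of_ne hb.1 fun h => hb0 h.symm)
  filter_upwards [hπ.ae_mem, hpos] with b hb hb'
  rcases hb.2.eq_or_lt with h | h
  · exact Or.inr h
  · exact Or.inl ⟨hb'.resolve_right h.ne, h⟩

theorem IsStationaryDistribution.atom_pos [IsProbabilityMeasure ν]
    (hν : IsHarvestLaw ν) {π : Measure ℝ} (hπ : IsStationaryDistribution pol K M ν π) :
    0 < π {K} := by
  have := hπ.isProbabilityMeasure
  rw [← hπ.push_eq, push_eq_add_dirac (hπ.ae_mem.mono fun _ h => h.1)]
  simpa using Or.inr (hν.Ici_pos K)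

end HarvestLaw

/-! ### Paths of the storage process -/

/-- The storage path with initial value `b`, driven by the harvests `x`. -/
def path (pol : Policy) (K M b : ℝ) (x : ℕ → ℝ) : ℕ → ℝ
  | 0 => b
  | n + 1 => step pol K M (path pol K M b x n) (x n)

theorem measurable_path (pol : Policy) (K M : ℝ) :
    Measurable (fun p : ℝ × (ℕ → ℝ) => path pol K M p.1 p.2) := by
  refine measurable_pi_lambda _ fun n => ?_
  induction n with
  | zero => exact measurable_fst
  | succ n ih =>
    exact (measurable_step pol K M).comp
      (ih.prodMk ((measurable_pi_apply n).comp measurable_snd))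

theorem iterate_shift_apply {α : Type*} (n : ℕ) (b : ℕ → α) :
    (fun (b : ℕ → α) i => b (i + 1))^[n] b = fun i => b (i + n) := by
  induction n generalizing b with
  | zero => rfl
  | succ n ih =>
    rw [Function.iterate_succ_apply, ih]
    funext i
    congr 1

theorem mem_iff_shift_mem {α : Type*} {A : Set (ℕ → α)}
    (hA : (fun (b : ℕ → α) i => b (i + 1)) ⁻¹' A = A) (n : ℕ) (b : ℕ → α) :
    b ∈ A ↔ (fun i => b (i + n)) ∈ A := by
  have h := congrArg (b ∈ ·) (((Function.IsFixedPt.preimage_iterate hA n) :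
    (fun (b : ℕ → α) i => b (i + 1))^[n] ⁻¹' A = A))
  simp only [mem_preimage, iterate_shift_apply, eq_iff_iff] at h
  exact h.symm

/-! ### Independence and tail events of the harvests -/

section Tail

theorem measurable_shift_tail {Ω : Type*} (X : ℕ → Ω → ℝ) (n : ℕ) :
    Measurable[⨆ i ∈ Ici n, MeasurableSpace.comap (X i) inferInstance]
      (fun ω i => X (i + n) ω) := by
  refine @measurable_pi_lambda _ _ _ (_) _ _ fun i => ?_
  refine Measurable.mono (comap_measurable (X (i + n))) ?_ le_rfl
  exact le_iSup₂_of_le (i + n) (mem_Ici.2 (Nat.le_add_left _ _)) le_rfl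

variable {Ω : Type*} [MeasurableSpace Ω] {P : Measure Ω} {X : ℕ → Ω → ℝ}

theorem _root_.ProbabilityTheory.IndepFun.prodMk_left {α β γ : Type*} [MeasurableSpace α]
    [MeasurableSpace β] [MeasurableSpace γ] [IsProbabilityMeasure P] {U : Ω → α} {V : Ω → β}
    {W : Ω → γ} (hU : Measurable U) (hV : Measurable V) (hW : Measurable W)
    (h : IndepFun U (fun ω => (V ω, W ω)) P) (hVW : IndepFun V W P) :
    IndepFun (fun ω => (U ω, V ω)) W P := by
  have hUV : IndepFun U V P := h.comp measurable_id measurable_fst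
  rw [indepFun_iff_map_prod_eq_prod_map_map (by fun_prop) (by fun_prop)] at h hVW hUV ⊢
  have := Measure.isProbabilityMeasure_map (μ := P) hW.aemeasurable
  have := Measure.isProbabilityMeasure_map (μ := P) hV.aemeasurable
  apply MeasurableEquiv.prodAssoc.map_measurableEquiv_injective
  rw [hUV, Measure.prodAssoc_prod, ← hVW, ← h, Measure.map_map (by fun_prop) (by fun_prop)]
  rfl

theorem indepFun_zero_shift (hX : ∀ i, Measurable (X i)) (h : iIndepFun X P) :
    IndepFun (X 0) (fun ω i => X (i + 1) ω) P := by
  have hd : Disjoint ({0} : Set ℕ) (Ici 1) := by simp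
  have := indep_iSup_of_disjoint (fun i => (hX i).comap_le) h.iIndep hd
  refine indep_of_indep_of_le_left (indep_of_indep_of_le_right this ?_) ?_
  · exact (measurable_shift_tail X 1).comap_le
  · simp

/-- Kolmogorov's zero-one law for an event that is almost surely determined by the harvests from
slot `n` on, for every `n`. -/
theorem measure_zero_or_one_of_ae_tail [IsProbabilityMeasure P] (hX : ∀ i, Measurable (X i))
    (h : iIndepFun X P) {E : Set Ω} {T : ℕ → Set Ω}
    (hT : ∀ n, MeasurableSet[⨆ i ∈ Ici n, MeasurableSpace.comap (X i) inferInstance] (T n))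
    (hE : ∀ᵐ ω ∂P, ∀ n, ω ∈ T n ↔ ω ∈ E) : P E = 0 ∨ P E = 1 := by
  -- `E` itself need not be a tail event; the limsup of the `T n` is a genuine one, almost surely
  -- equal to `E`.
  have hEl : P E = P (limsup T atTop) := by
    refine measure_congr (eventuallyEq_set.2 ?_)
    filter_upwards [hE] with ω hω
    simp [mem_limsup_iff_frequently_mem, hω]
  rw [hEl]
  refine measure_zero_or_one_of_measurableSet_limsup_atTop (fun i => (hX i).comap_le) h.iIndep ?_
  rw [limsup_eq_iInf_iSup_of_nat (u := fun i => MeasurableSpace.comap (X i) _),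
    MeasurableSpace.measurableSet_iInf]
  intro n
  rw [← limsup_nat_add T n]
  refine @MeasurableSet.measurableSet_limsup _ (_) _ fun k => ?_
  have hle : (⨆ i ∈ Ici (k + n), MeasurableSpace.comap (X i) inferInstance) ≤
      ⨆ i ≥ n, MeasurableSpace.comap (X i) inferInstance :=
    biSup_mono fun i hi => le_trans (Nat.le_add_left n k) hi
  exact hle _ (hT (k + n))

end Tail

/-! ### Laws, coupling and ergodicity of storage processes -/

namespace IsStorageProcess

variable {pol : Policy} {K M : ℝ} {ν : Measure ℝ} {Ω : Type*} [MeasurableSpace Ω]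
  {P : Measure Ω} {X B : ℕ → Ω → ℝ}

theorem eq_path (h : IsStorageProcess pol K M ν P X B) (ω : Ω) :
    (fun i => B i ω) = path pol K M (B 0 ω) (fun i => X i ω) := by
  funext n
  induction n with
  | zero => rfl
  | succ n ih => rw [h.storage_eq, ih]; rfl

theorem measurable_harvests (h : IsStorageProcess pol K M ν P X B) :
    Measurable (fun ω i => X i ω) :=
  measurable_pi_lambda _ h.measurable_harvest

theorem measurable_storages (h : IsStorageProcess pol K M ν P X B) :
    Measurable (fun ω i => B i ω) := by
  rw [funext h.eq_path]
  exact (measurable_path pol K M).comp (h.measurable_init.prodMk h.measurable_harvests)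

theorem measurable_storage (h : IsStorageProcess pol K M ν P X B) (n : ℕ) : Measurable (B n) :=
  (measurable_pi_apply n).comp h.measurable_storages

theorem indepFun_init_zero (h : IsStorageProcess pol K M ν P X B) :
    IndepFun (B 0) (X 0) P :=
  h.indep_init.comp measurable_id (measurable_pi_apply 0)

theorem ae_harvest_nonneg (hν : IsHarvestLaw ν) (h : IsStorageProcess pol K M ν P X B) :
    ∀ᵐ ω ∂P, ∀ i, 0 ≤ X i ω :=
  ae_all_iff.2 fun i => ae_of_ae_map (h.measurable_harvest i).aemeasurable
    (by rw [h.law_harvest]; exact hν.ae_nonneg)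

/-- Coupling: the process and the path started with a full buffer at slot `n` merge. -/
theorem exists_merge (hK : 0 < K) (h : IsStorageProcess pol K M ν P X B) {ω : Ω}
    (h0 : B 0 ω ∈ Icc 0 K) (hX : ∀ i, 0 ≤ X i ω) (hf : ∃ᶠ i in atTop, K ≤ X i ω) (n : ℕ) :
    ∃ m, ∀ i, path pol K M K (fun j => X (j + n) ω) (i + m) = B (i + (m + n)) ω := by
  have hB : ∀ i, 0 ≤ B i ω := fun i => by
    induction i with
    | zero => exact h0.1
    | succ i ih => rw [h.storage_eq]; exact step_nonneg hK ih (hX i)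
  have hp : ∀ i, 0 ≤ path pol K M K (fun j => X (j + n) ω) i := fun i => by
    induction i with
    | zero => exact hK.le
    | succ i ih => exact step_nonneg hK ih (hX _)
  obtain ⟨k, hk, hkX⟩ := frequently_atTop.1 hf n
  obtain ⟨l, rfl⟩ := Nat.exists_eq_add_of_le' hk
  -- The harvest of slot `l + n` fills both buffers, so both paths equal `K` one slot later and
  -- coincide from then on.
  refine ⟨l + 1, fun i => ?_⟩
  induction i with
  | zero =>
    rw [show 0 + (l + 1 + n) = l + n + 1 by ring, zero_add, h.storage_eq,
      step_eq_capacity (hB _) hkX]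
    exact step_eq_capacity (hp l) hkX
  | succ i ih =>
    rw [show i + 1 + (l + 1 + n) = i + (l + 1 + n) + 1 by ring, h.storage_eq, ← ih,
      show i + 1 + (l + 1) = i + (l + 1) + 1 by ring, path, add_assoc i]

variable [IsProbabilityMeasure P]

theorem map_harvests (h : IsStorageProcess pol K M ν P X B) :
    P.map (fun ω i => X i ω) = Measure.infinitePi fun _ => ν := by
  rw [(iIndepFun_iff_map_fun_eq_infinitePi_map h.measurable_harvest).1 h.iIndep_harvest]
  simp_rw [h.law_harvest]

/-- The law of the path is determined by the initial law. -/
theorem map_storages (h : IsStorageProcess pol K M ν P X B) :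
    P.map (fun ω i => B i ω) = ((P.map (B 0)).prod (Measure.infinitePi fun _ => ν)).map
      (fun p => path pol K M p.1 p.2) := by
  rw [← h.map_harvests, ← (indepFun_iff_map_prod_eq_prod_map_map h.measurable_init.aemeasurable
    h.measurable_harvests.aemeasurable).1 h.indep_init,
    Measure.map_map (measurable_path pol K M) (h.measurable_init.prodMk h.measurable_harvests)]
  rw [funext h.eq_path]
  rfl

theorem map_one (h : IsStorageProcess pol K M ν P X B) :
    P.map (B 1) = push pol K M ν (P.map (B 0)) := by
  rw [push, ← h.law_harvest 0, ← (indepFun_iff_map_prod_eq_prod_map_map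
    h.measurable_init.aemeasurable (h.measurable_harvest 0).aemeasurable).1 h.indepFun_init_zero,
    Measure.map_map (measurable_step pol K M) (h.measurable_init.prodMk (h.measurable_harvest 0))]
  congr 1
  funext ω
  exact h.storage_eq 0 ω

theorem indepFun_one_shift (h : IsStorageProcess pol K M ν P X B) :
    IndepFun (B 1) (fun ω i => X (i + 1) ω) P := by
  have hs : Measurable (fun ω i => X (i + 1) ω) :=
    measurable_pi_lambda _ fun i => h.measurable_harvest (i + 1)
  have hB := h.measurable_init
  have hX := h.measurable_harvest 0
  have h1 : IndepFun (B 0) (fun ω => (X 0 ω, fun i => X (i + 1) ω)) P :=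
    h.indep_init.comp (ψ := fun x : ℕ → ℝ => (x 0, fun i => x (i + 1))) measurable_id
      (by fun_prop)
  have h2 := indepFun_zero_shift h.measurable_harvest h.iIndep_harvest
  have h3 : IndepFun (fun ω => (B 0 ω, X 0 ω)) (fun ω i => X (i + 1) ω) P :=
    h1.prodMk_left hB hX hs h2
  have h5 := h3.comp (measurable_step pol K M) measurable_id
  rw [show B 1 = (fun p : ℝ × ℝ => step pol K M p.1 p.2) ∘ fun ω => (B 0 ω, X 0 ω) from
    funext (h.storage_eq 0)]
  exact h5

/-- The process observed from slot `1` on is again a storage process. -/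
theorem shift (hK : 0 < K) (hν : IsHarvestLaw ν) (h : IsStorageProcess pol K M ν P X B) :
    IsStorageProcess pol K M ν P (fun i => X (i + 1)) (fun i => B (i + 1)) where
  measurable_harvest i := h.measurable_harvest (i + 1)
  law_harvest i := h.law_harvest (i + 1)
  iIndep_harvest := h.iIndep_harvest.precomp (add_left_injective 1)
  measurable_init := h.measurable_storage 1
  init_mem := by
    have h0 : ∀ᵐ ω ∂P, 0 ≤ X 0 ω :=
      ae_of_ae_map (h.measurable_harvest 0).aemeasurable (by rw [h.law_harvest]; exact hν.ae_nonneg)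
    filter_upwards [h.init_mem, h0] with ω hb hx
    rw [h.storage_eq]
    exact ⟨step_nonneg hK hb.1 hx, step_le⟩
  indep_init := h.indepFun_one_shift
  storage_eq i ω := h.storage_eq (i + 1) ω

theorem map_storage (hK : 0 < K) (hν : IsHarvestLaw ν) (h : IsStorageProcess pol K M ν P X B)
    (n : ℕ) : P.map (B n) = (push pol K M ν)^[n] (P.map (B 0)) := by
  induction n generalizing X B with
  | zero => rfl
  | succ n ih => rw [Function.iterate_succ_apply, ← h.map_one, ih (h.shift hK hν)]

/-- The shifted process is a storage process with the same initial law, and that law determines the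
law of the path. -/
theorem measurePreserving_shift (hK : 0 < K) (hν : IsHarvestLaw ν)
    (h : IsStorageProcess pol K M ν P X B) (hstat : P.map (B 1) = P.map (B 0)) :
    MeasurePreserving (fun (b : ℕ → ℝ) i => b (i + 1)) (P.map fun ω i => B i ω)
      (P.map fun ω i => B i ω) := by
  refine ⟨by fun_prop, ?_⟩
  rw [Measure.map_map (by fun_prop) h.measurable_storages]
  refine (h.shift hK hν).map_storages.trans ?_
  rw [h.map_storages, hstat]

/-- Almost surely, the harvest fills the buffer infinitely often. -/
theorem ae_frequently_filled (hν : IsHarvestLaw ν) (h : IsStorageProcess pol K M ν P X B) :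
    ∀ᵐ ω ∂P, ∃ᶠ i in atTop, K ≤ X i ω := by
  have hs : ∀ i, MeasurableSet (X i ⁻¹' Ici K) := fun i => h.measurable_harvest i measurableSet_Ici
  have hi : iIndepSet (fun i => X i ⁻¹' Ici K) P :=
    iIndepSet_iff_meas_biInter hs |>.2 fun s =>
      h.iIndep_harvest.measure_inter_preimage_eq_mul s fun i _ => measurableSet_Ici
  have hp : ∀ i, P (X i ⁻¹' Ici K) = ν (Ici K) := fun i => by
    rw [← h.law_harvest i, Measure.map_apply (h.measurable_harvest i) measurableSet_Ici]
  have h1 := measure_limsup_eq_one hs hi (by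
    simp_rw [hp]
    exact ENNReal.tsum_const_eq_top_of_ne_zero (hν.Ici_pos K).ne')
  have h2 := (mem_ae_iff_prob_eq_one (MeasurableSet.measurableSet_limsup hs)).2 h1
  filter_upwards [h2] with ω hω
  simpa [mem_limsup_iff_frequently_mem] using hω

theorem measure_invariant_zero_or_one (hK : 0 < K) (hν : IsHarvestLaw ν)
    (h : IsStorageProcess pol K M ν P X B) {A : Set (ℕ → ℝ)} (hA : MeasurableSet A)
    (hinv : (fun (b : ℕ → ℝ) i => b (i + 1)) ⁻¹' A = A) :
    P.map (fun ω i => B i ω) A = 0 ∨ P.map (fun ω i => B i ω) A = 1 := by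
  rw [Measure.map_apply h.measurable_storages hA]
  refine measure_zero_or_one_of_ae_tail h.measurable_harvest h.iIndep_harvest
    -- Restarting with a full buffer at slot `n` removes all dependence on `B 0` and earlier
    -- harvests; by merging and invariance, membership in `A` is almost surely unchanged.
    (T := fun n => (fun ω i => X (i + n) ω) ⁻¹' (path pol K M K ⁻¹' A)) (fun n => ?_) ?_
  · exact measurable_shift_tail X n
      (((measurable_path pol K M).comp measurable_prodMk_left) hA)
  · filter_upwards [h.init_mem, h.ae_harvest_nonneg hν, h.ae_frequently_filled hν]
      with ω h0 hX hf n
    obtain ⟨m, hm⟩ := h.exists_merge hK h0 hX hf n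
    simp only [mem_preimage]
    rw [mem_iff_shift_mem hinv m, mem_iff_shift_mem hinv (m + n) fun i => B i ω]
    simp only [hm]

theorem isStationaryErgodic (hK : 0 < K) (hν : IsHarvestLaw ν)
    (h : IsStorageProcess pol K M ν P X B) (hstat : P.map (B 1) = P.map (B 0)) :
    IsStationaryErgodic P B where
  toMeasurePreserving := h.measurePreserving_shift hK hν hstat
  aeconst_set A hA hinv := by
    have := Measure.isProbabilityMeasure_map (μ := P) h.measurable_storages.aemeasurable
    rw [eventuallyConst_set']
    rcases h.measure_invariant_zero_or_one hK hν hA hinv with h0 | h1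
    · exact Or.inl (ae_eq_empty.2 h0)
    · exact Or.inr (ae_eq_univ.2 ((prob_compl_eq_zero_iff hA).2 h1))

end IsStorageProcess

end

end EnergyStorage

theorem mainTheorem2 (pol : EnergyStorage.Policy) (K M : ℝ) (hK : 0 < K) (hM : 0 < M)
    (ν : Measure ℝ) [IsProbabilityMeasure ν] (hν : EnergyStorage.IsHarvestLaw ν) :
    ∃ π : Measure ℝ,
      -- existence and uniqueness of the stationary distribution
      EnergyStorage.IsStationaryDistribution pol K M ν π ∧
      (∀ π' : Measure ℝ, EnergyStorage.IsStationaryDistribution pol K M ν π' → π' = π) ∧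
      -- a density on `(0, K)`, an atom at `K`, and nothing else
      (∃ g : ℝ → ℝ≥0∞, Measurable g ∧
        π = (volume.restrict (Ioo 0 K)).withDensity g + π {K} • Measure.dirac K) ∧
      0 < π {K} ∧
      -- started from the stationary distribution, the process is stationary and ergodic
      (∀ {Ω : Type*} [MeasurableSpace Ω] (P : Measure Ω) [IsProbabilityMeasure P]
        (X B : ℕ → Ω → ℝ), EnergyStorage.IsStorageProcess pol K M ν P X B →
        P.map (B 0) = π → EnergyStorage.IsStationaryErgodic P B) ∧
      -- from any initial distribution, convergence to the limit in total variation
      (∀ {Ω : Type*} [MeasurableSpace Ω] (P : Measure Ω) [IsProbabilityMeasure P]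
        (X B : ℕ → Ω → ℝ), EnergyStorage.IsStorageProcess pol K M ν P X B →
        Tendsto (fun n => EnergyStorage.tvDist (P.map (B n)) π) atTop (𝓝 0)) := by
  have hπ := EnergyStorage.isStationaryDistribution_stationary (pol := pol) (M := M) hK hν
  refine ⟨EnergyStorage.stationary pol K M ν, hπ, fun π' hπ' => hπ'.unique hK hν hπ,
    hπ.exists_density hν, hπ.atom_pos hν, fun P _ X B h hB => ?_, fun P _ X B h => ?_⟩
  · exact h.isStationaryErgodic hK hν (by rw [h.map_one, hB, hπ.push_eq])
  · have := Measure.isProbabilityMeasure_map (μ := P) h.measurable_init.aemeasurable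
    refine (hπ.tendsto_tvDist hK hν
      ((ae_map_iff h.measurable_init.aemeasurable measurableSet_Icc).2 h.init_mem)).congr
      fun n => ?_
    rw [h.map_storage hK hν n]
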